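/- Let $\lambda:[0,\infty)\to[0,\infty)$ be continuous, $\mu>0$, $\theta\ge 0$, and let $c\ge 1$ be an integer. Let $Q=(Q(t))_{t\ge0}$ be the (nonstationary) Erlang-A, i.e. $M(t)/M/c+M$, queue length process: the $\mathbb{N}$-valued Markov jump process with right-continuous paths with left limits that jumps at time $t$ from $n$ to $n+1$ at rate $\lambda(t)$ and from $n$ to $n-1$ at rate $\mu\,(n\wedge c)+\theta\,(n-c)^+$ (formally, a solution of the martingale problem for this generator). Let $T\ge 0$ and let $J\subseteq\mathbb{R}$ be an interval containing $0$ (for instance $[0,\infty)$ or $\mathbb{R}$) such that $E[e^{\alpha Q(0)}]<\infty$ for all $\alpha\in J$. Let $M_f(t,\alpha)=E[e^{\alpha Q_f(t)}]$ denote the fluid approximation of the moment generating function, that is, a continuous, positive, classical solution on $[0,T]\times J$ of $$\frac{\partial M_f}{\partial t}=\lambda(t)(e^{\alpha}-1)M_f+\theta(e^{-\alpha}-1)\frac{\partial M_f}{\partial\alpha}-(\theta-\mu)(e^{-\alpha}-1)\Big(\frac{\partial M_f}{\partial\alpha}\wedge c\,M_f\Big),$$ with the same initial value as $Q$, i.e.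 $M_f(0,\alpha)=E[e^{\alpha Q(0)}]$ for $\alpha\in J$. Then for all $t\in[0,T]$ and $\alpha\in J$, $E[e^{\alpha Q(t)}]$ is finite and: - if $\alpha\ge 0$, then $\log E[e^{\alpha Q(t)}]\ge\log E[e^{\alpha Q_f(t)}]$ when $\theta<\mu$, and $\log E[e^{\alpha Q(t)}]\le\log E[e^{\alpha Q_f(t)}]$ when $\theta>\mu$; - if $\alpha\le 0$, both inequalities are reversed: $\log E[e^{\alpha Q(t)}]\le\log E[e^{\alpha Q_f(t)}]$ when $\theta<\mu$, and $\log E[e^{\alpha Q(t)}]\ge\log E[e^{\alpha Q_f(t)}]$ when $\theta>\mu$; - if $\theta=\mu$, then $\log E[e^{\alpha Q(t)}]=\log E[e^{\alpha Q_f(t)}]$. -/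

import Mathlib

open MeasureTheory ProbabilityTheory Set Filter Topology
open scoped NNReal

noncomputable section

/-- The total departure rate `δ(x, c) = μ (x ∧ c) + θ (x - c)⁺` of the Erlang-A queue with service
rate `μ`, abandonment rate `θ` and `c` servers, when `x` customers are present. -/
def erlangDepartureRate (μ θ : ℝ) (c : ℕ) (x : ℝ) : ℝ :=
  μ * min x c + θ * max (x - c) 0

/-- The generator at time `s` of the `M(t)/M/c+M` queue: arrivals (`n → n + 1`) at rate `lam s`,
departures (`n → n - 1`) at rate `δ(n, c)`. As `δ(0, c) = 0`, the truncated subtraction is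
harmless at `n = 0`. -/
def erlangGenerator (lam : ℝ → ℝ) (μ θ : ℝ) (c : ℕ) (s : ℝ) (f : ℕ → ℝ) (n : ℕ) : ℝ :=
  lam s * (f (n + 1) - f n) + erlangDepartureRate μ θ c n * (f (n - 1) - f n)

/-- `Q` is a (nonstationary) Erlang-A queue length process, as the solution of the martingale
problem for its generator: `Q` takes values in `ℕ`, has right-continuous paths with left limits
(for the discrete topology of `ℕ`), is adapted to `ℱ`, and for each finitely supported `f`
`f(Q(t)) - f(Q(0)) - ∫₀ᵗ (A_s f)(Q(s)) ds` is an `ℱ`-martingale. -/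
structure IsErlangA {Ω : Type*} [mΩ : MeasurableSpace Ω] (P : Measure Ω) (ℱ : Filtration ℝ≥0 mΩ)
    (lam : ℝ → ℝ) (μ θ : ℝ) (c : ℕ) (Q : ℝ≥0 → Ω → ℕ) : Prop where
  adapted : ∀ t, Measurable[ℱ t] (Q t)
  rightCont : ∀ ω t, ContinuousWithinAt (fun s => Q s ω) (Ici t) t
  leftLim : ∀ ω t, ∃ l, Tendsto (fun s => Q s ω) (𝓝[<] t) (𝓝 l)
  martingale : ∀ f : ℕ → ℝ, f.support.Finite →
    Martingale (fun (t : ℝ≥0) ω => f (Q t ω) - f (Q 0 ω) -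
      ∫ s in (0 : ℝ)..t, erlangGenerator lam μ θ c s f (Q s.toNNReal ω)) ℱ P

/-- `M t α` is a (positive, classical) solution for `0 ≤ t ≤ T`, `α ∈ J` of the partial
differential equation that defines the fluid approximation `M_f(t, α) = E[e^{α Q_f(t)}]` of the
moment generating function,
`∂M/∂t = lam(t) (e^α - 1) M + θ (e^{-α} - 1) ∂M/∂α - (θ - μ) (e^{-α} - 1) (∂M/∂α ∧ c M)`.
Derivatives at end points of `[0, T]` and of the interval `J` are one-sided. -/
structure IsFluidMGF (lam : ℝ → ℝ) (μ θ : ℝ) (c : ℕ) (T : ℝ) (J : Set ℝ) (M : ℝ → ℝ → ℝ) :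
    Prop where
  pos : ∀ t ∈ Icc 0 T, ∀ α ∈ J, 0 < M t α
  cont : ContinuousOn (fun x : ℝ × ℝ => M x.1 x.2) (Icc 0 T ×ˢ J)
  pde : ∀ t ∈ Icc 0 T, ∀ α ∈ J, ∃ p : ℝ,
    HasDerivWithinAt (fun a => M t a) p J α ∧
    HasDerivWithinAt (fun s => M s α)
      (lam t * (Real.exp α - 1) * M t α + θ * (Real.exp (-α) - 1) * p
        - (θ - μ) * (Real.exp (-α) - 1) * min p (c * M t α)) (Icc 0 T) t

end

/-! Write M(t,α) = E[e^{αQ(t)}], p = ∂M/∂α = E[Q e^{αQ}] and r = E[(Q ∧ c) e^{αQ}]. The forward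
equation shows that M solves the fluid equation with `min p (c * M)` replaced by r, and r ≤ `min p
(c * M)` because the minimum is concave (`IsErlangA.exists_hasDeriv_expectAt_expFun`). The sign of
(θ - μ)(e^{-α} - 1) decides whether M is a sub- or a supersolution.

This becomes an inequality between M and Mf by a maximum principle for σ(M - Mf), σ = ±1, on [0,T] ×
[0,b] or [0,T] × [a,0] (`nonpos_of_deriv_le_at_spatial_max`, `fluid_comparison`). Nothing is known
at the outer end point, but a spatial maximum there still gives ∂(M - Mf)/∂α a sign, and it is the
sign that the transport term needs. At α = 0 both functions are constant in time and agree.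

The martingale problem only admits finitely supported test functions. Constants are added for free;
e^{αn} is then reached through e^{α(n ∧ N)}, with tails controlled by a moment of order β > α. For α
< 0 take β = 0; for α > 0 a Grönwall bound propagates the initial moment
(`IsErlangA.exp_moment_bound`), and the top exponent is recovered by continuity. -/

/-! ### Maximum principle and one-sided derivative tests -/

/-- A parabolic-type maximum principle without boundary conditions: if `w ≤ 0` initially and the
time derivative of `w` is at most `K w` wherever `w` is positive and maximal in space, then
`w ≤ 0` for all times. -/
theorem nonpos_of_deriv_le_at_spatial_max {X : Type*} [TopologicalSpace X] {S : Set X}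
    (hS : IsCompact S) {T K : ℝ} {w : ℝ → X → ℝ}
    (hw : ContinuousOn (fun z : ℝ × X => w z.1 z.2) (Icc 0 T ×ˢ S))
    (h0 : ∀ x ∈ S, w 0 x ≤ 0)
    (hd : ∀ t ∈ Ioc 0 T, ∀ x ∈ S, 0 < w t x → IsMaxOn (w t) S x →
      ∃ d, HasDerivWithinAt (fun s => w s x) d (Icc 0 T) t ∧ d ≤ K * w t x) :
    ∀ t ∈ Icc 0 T, ∀ x ∈ S, w t x ≤ 0 := by
  intro t₀ ht₀ x₀ hx₀
  by_contra! hpos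
  -- The weight has rate K + 1 rather than K, so that at a positive space-time maximum the weighted
  -- time derivative is strictly negative.
  have hcont : ContinuousOn (fun z : ℝ × X => Real.exp (-(K + 1) * z.1) * w z.1 z.2)
      (Icc 0 T ×ˢ S) := by
    refine ContinuousOn.mul ?_ hw
    exact (Real.continuous_exp.comp (continuous_const.mul continuous_fst)).continuousOn
  obtain ⟨⟨t, x⟩, ⟨ht, hx⟩, hmax⟩ :=
    (isCompact_Icc.prod hS).exists_isMaxOn ⟨(t₀, x₀), ht₀, hx₀⟩ hcont
  simp only at ht hx
  have hmax' : ∀ s ∈ Icc 0 T, ∀ y ∈ S,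
      Real.exp (-(K + 1) * s) * w s y ≤ Real.exp (-(K + 1) * t) * w t x :=
    fun s hs y hy => hmax (show (s, y) ∈ Icc 0 T ×ˢ S from ⟨hs, hy⟩)
  have hwpos : 0 < w t x := by
    have h1 := hmax' t₀ ht₀ x₀ hx₀
    have h2 : 0 < Real.exp (-(K + 1) * t) * w t x := lt_of_lt_of_le (by positivity) h1
    exact pos_of_mul_pos_right h2 (Real.exp_pos _).le
  have ht0 : 0 < t := by
    rcases ht.1.eq_or_lt with h | h
    · subst h; exact absurd (h0 x hx) (not_le.2 hwpos)
    · exact h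
  obtain ⟨d, hd1, hd2⟩ := hd t ⟨ht0, ht.2⟩ x hx hwpos (fun y hy => by
    have := hmax' t ht y hy
    exact le_of_mul_le_mul_left this (Real.exp_pos _))
  have hder : HasDerivWithinAt (fun s => Real.exp (-(K + 1) * s) * w s x)
      (Real.exp (-(K + 1) * t) * (-(K + 1)) * w t x + Real.exp (-(K + 1) * t) * d)
      (Icc 0 t) t := by
    have h1 : HasDerivAt (fun s => Real.exp (-(K + 1) * s))
        (Real.exp (-(K + 1) * t) * (-(K + 1))) t := by
      simpa using ((hasDerivAt_id t).const_mul (-(K + 1))).exp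
    exact h1.hasDerivWithinAt.mul (hd1.mono (Icc_subset_Icc_right ht.2))
  -- Only earlier times are compared, so the case t = T needs no separate treatment.
  have hge : 0 ≤ Real.exp (-(K + 1) * t) * (-(K + 1)) * w t x + Real.exp (-(K + 1) * t) * d := by
    have hcl : t ∈ closure (Ioo 0 t) := by
      rw [closure_Ioo ht0.ne]; exact right_mem_Icc.2 ht0.le
    have : (𝓝[Ioo 0 t] t).NeBot := mem_closure_iff_nhdsWithin_neBot.1 hcl
    have hs := hasDerivWithinAt_iff_tendsto_slope.1 (hder.mono Ioo_subset_Icc_self)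
    rw [sdiff_singleton_eq_self (fun h => lt_irrefl _ h.2)] at hs
    refine ge_of_tendsto hs ?_
    filter_upwards [self_mem_nhdsWithin] with s hs'
    rw [slope_def_field]
    exact div_nonneg_of_nonpos (sub_nonpos.2 (hmax' s ⟨hs'.1.le, hs'.2.le.trans ht.2⟩ x hx))
      (sub_nonpos.2 hs'.2.le)
  have : Real.exp (-(K + 1) * t) * (-(K + 1)) * w t x + Real.exp (-(K + 1) * t) * d
      = Real.exp (-(K + 1) * t) * (d - K * w t x - w t x) := by ring
  rw [this] at hge
  have := nonneg_of_mul_nonneg_right hge (Real.exp_pos _)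
  linarith

/-- The derivative is nonnegative at a maximum on `[a, b]` other than `a`. -/
theorem HasDerivWithinAt.nonneg_of_isMaxOn_Icc {f : ℝ → ℝ} {a b x d : ℝ}
    (hd : HasDerivWithinAt f d (Icc a b) x) (hx : x ∈ Ioc a b) (hmax : IsMaxOn f (Icc a b) x) :
    0 ≤ d := by
  have hcl : x ∈ closure (Ioo a x) := by
    rw [closure_Ioo hx.1.ne]; exact right_mem_Icc.2 hx.1.le
  have : (𝓝[Ioo a x] x).NeBot := mem_closure_iff_nhdsWithin_neBot.1 hcl
  have hsub : Ioo a x ⊆ Icc a b := fun s hs => ⟨hs.1.le, hs.2.le.trans hx.2⟩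
  have hs := hasDerivWithinAt_iff_tendsto_slope.1 (hd.mono hsub)
  rw [sdiff_singleton_eq_self (fun h => lt_irrefl _ h.2)] at hs
  refine ge_of_tendsto hs ?_
  filter_upwards [self_mem_nhdsWithin] with s hs'
  rw [slope_def_field]
  exact div_nonneg_of_nonpos (sub_nonpos.2 (hmax (hsub hs'))) (sub_nonpos.2 hs'.2.le)

/-- The derivative is nonpositive at a maximum on `[a, b]` other than `b`. -/
theorem HasDerivWithinAt.nonpos_of_isMaxOn_Icc {f : ℝ → ℝ} {a b x d : ℝ}
    (hd : HasDerivWithinAt f d (Icc a b) x) (hx : x ∈ Ico a b) (hmax : IsMaxOn f (Icc a b) x) :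
    d ≤ 0 := by
  have hcl : x ∈ closure (Ioo x b) := by
    rw [closure_Ioo hx.2.ne]; exact left_mem_Icc.2 hx.2.le
  have : (𝓝[Ioo x b] x).NeBot := mem_closure_iff_nhdsWithin_neBot.1 hcl
  have hsub : Ioo x b ⊆ Icc a b := fun s hs => ⟨hx.1.trans hs.1.le, hs.2.le⟩
  have hs := hasDerivWithinAt_iff_tendsto_slope.1 (hd.mono hsub)
  rw [sdiff_singleton_eq_self (fun h => lt_irrefl _ h.1)] at hs
  refine le_of_tendsto hs ?_
  filter_upwards [self_mem_nhdsWithin] with s hs'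
  rw [slope_def_field]
  exact div_nonpos_of_nonpos_of_nonneg (sub_nonpos.2 (hmax (hsub hs'))) (sub_nonneg.2 hs'.1.le)

/-! ### Joint continuity and joint measurability -/

/-- A separately continuous function that is monotone in the second variable is continuous. -/
theorem continuous_uncurry_of_monotone {X : Type*} [TopologicalSpace X] {F : X → ℝ → ℝ}
    (h1 : ∀ a, Continuous fun x => F x a) (h2 : ∀ x, Continuous (F x)) (hm : ∀ x, Monotone (F x)) :
    Continuous (fun z : X × ℝ => F z.1 z.2) := by
  rw [continuous_iff_continuousAt]
  rintro ⟨x, a⟩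
  rw [ContinuousAt, tendsto_order]
  constructor
  · intro l hl
    -- A fixed b slightly below a already has F x b > l. This persists for nearby x, and
    -- monotonicity passes it to every second argument above b.
    have : ∀ᶠ b in 𝓝[<] a, l < F x b :=
      ((h2 x).tendsto a).mono_left nhdsWithin_le_nhds |>.eventually (lt_mem_nhds hl)
    obtain ⟨b, hb, hba⟩ := (this.and self_mem_nhdsWithin).exists
    rw [nhds_prod_eq]
    filter_upwards [(((h1 b).tendsto x).eventually (lt_mem_nhds hb)).prod_mk (lt_mem_nhds hba)]
      with z hz
    exact hz.1.trans_le (hm _ hz.2.le)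
  · intro l hl
    have : ∀ᶠ b in 𝓝[>] a, F x b < l :=
      ((h2 x).tendsto a).mono_left nhdsWithin_le_nhds |>.eventually (gt_mem_nhds hl)
    obtain ⟨b, hb, hba⟩ := (this.and self_mem_nhdsWithin).exists
    rw [nhds_prod_eq]
    filter_upwards [(((h1 b).tendsto x).eventually (gt_mem_nhds hb)).prod_mk (gt_mem_nhds hba)]
      with z hz
    exact (hm _ hz.2.le).trans_lt hz.1

theorem continuousOn_uncurry_Icc_of_monotoneOn {F : ℝ → ℝ → ℝ} {T a b : ℝ}
    (hT : 0 ≤ T) (hab : a ≤ b)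
    (h1 : ∀ x ∈ Icc a b, ContinuousOn (fun t => F t x) (Icc 0 T))
    (h2 : ∀ t ∈ Icc 0 T, ContinuousOn (F t) (Icc a b))
    (hm : ∀ t ∈ Icc 0 T, MonotoneOn (F t) (Icc a b)) :
    ContinuousOn (fun z : ℝ × ℝ => F z.1 z.2) (Icc 0 T ×ˢ Icc a b) := by
  have key : Continuous (fun z : ℝ × ℝ =>
      (fun t x => F (projIcc 0 T hT t) (projIcc a b hab x)) z.1 z.2) := by
    refine continuous_uncurry_of_monotone
      (F := fun t x => F (projIcc 0 T hT t) (projIcc a b hab x)) (fun x => ?_) (fun t => ?_)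
      (fun t => ?_)
    · exact (h1 _ (projIcc a b hab x).2).comp_continuous
        (continuous_subtype_val.comp continuous_projIcc) (fun t => (projIcc 0 T hT t).2)
    · exact (h2 _ (projIcc 0 T hT t).2).comp_continuous
        (continuous_subtype_val.comp continuous_projIcc) (fun x => (projIcc a b hab x).2)
    · intro x y hxy
      exact hm _ (projIcc 0 T hT t).2 (projIcc a b hab x).2 (projIcc a b hab y).2
        (monotone_projIcc hab hxy)
  refine key.continuousOn.congr ?_
  rintro ⟨t, x⟩ ⟨ht, hx⟩
  simp only [projIcc_of_mem hT ht, projIcc_of_mem hab hx]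

/-- Joint measurability of a right-continuous process with values in `ℕ`. -/
theorem measurable_uncurry_of_rightCont {Ω : Type*} [MeasurableSpace Ω] {Q : ℝ≥0 → Ω → ℕ}
    (hm : ∀ t, Measurable (Q t)) (hc : ∀ ω t, ContinuousWithinAt (fun s => Q s ω) (Ici t) t) :
    Measurable (fun z : ℝ≥0 × Ω => Q z.1 z.2) := by
  -- Grid times approaching s from the right, as right-continuity demands; each `d k` has countably
  -- many values.
  let d : ℕ → ℝ≥0 → ℝ≥0 := fun k s => ((⌊s * (k + 1)⌋₊ : ℝ≥0) + 1) / (k + 1)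
  have hd : ∀ s, Tendsto (fun k => d k s) atTop (𝓝[≥] s) := by
    intro s
    have hpos : ∀ k : ℕ, (0 : ℝ≥0) < k + 1 := fun k => by positivity
    have hlow : ∀ k, s ≤ d k s := fun k => by
      rw [le_div_iff₀ (hpos k)]
      exact (Nat.lt_floor_add_one _).le
    have hup : ∀ k : ℕ, d k s ≤ s + 1 / (k + 1) := fun k => by
      rw [div_le_iff₀ (hpos k), add_mul, one_div, inv_mul_cancel₀ (hpos k).ne']
      gcongr
      exact Nat.floor_le (by positivity)
    refine tendsto_nhdsWithin_iff.2 ⟨?_, Eventually.of_forall hlow⟩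
    refine tendsto_of_tendsto_of_tendsto_of_le_of_le tendsto_const_nhds ?_ hlow hup
    have : Tendsto (fun k : ℕ => (1 : ℝ≥0) / (k + 1)) atTop (𝓝 0) :=
      tendsto_one_div_add_atTop_nhds_zero_nat
    simpa using this.const_add s
  have hmeas : ∀ k, Measurable (fun z : ℝ≥0 × Ω => Q (d k z.1) z.2) := by
    intro k
    let e : ℕ → ℝ≥0 := fun n => ((n : ℝ≥0) + 1) / (k + 1)
    let φ : ℝ≥0 → ℕ := fun s => ⌊s * (k + 1)⌋₊
    have hφ : Measurable φ := Nat.measurable_floor.comp (measurable_id.mul_const _)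
    have hde : d k = fun s => e (φ s) := rfl
    rw [hde]
    clear_value e φ
    have h1 : Measurable (fun z : ℕ × Ω => Q (e z.1) z.2) :=
      measurable_from_prod_countable_right (fun n => hm (e n))
    exact h1.comp ((hφ.comp measurable_fst).prodMk measurable_snd)
  clear_value d
  refine measurable_of_tendsto_metrizable hmeas ?_
  rw [tendsto_pi_nhds]
  rintro ⟨s, ω⟩
  exact Tendsto.comp (g := fun r => Q r ω) (hc ω s) (hd s)

/-! ### Forward equation for eventually constant test functions -/

noncomputable section

/-- The arrival part of the generator, for unit arrival rate. -/
def arrivalDiff (f : ℕ → ℝ) (n : ℕ) : ℝ := f (n + 1) - f n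

/-- The departure part of the generator. -/
def departureDiff (μ θ : ℝ) (c : ℕ) (f : ℕ → ℝ) (n : ℕ) : ℝ :=
  erlangDepartureRate μ θ c n * (f (n - 1) - f n)

/-- The expectation `E[g(Q(t))]`, for real times. -/
def expectAt {Ω : Type*} [MeasurableSpace Ω] (P : Measure Ω) (Q : ℝ≥0 → Ω → ℕ) (g : ℕ → ℝ)
    (t : ℝ) : ℝ := ∫ ω, g (Q t.toNNReal ω) ∂P

end

theorem exists_abs_le_of_eventually_const {f : ℕ → ℝ} {N : ℕ} {κ : ℝ} (hf : ∀ n ≥ N, f n = κ) :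
    ∃ B, ∀ n, |f n| ≤ B := by
  refine ⟨|κ| + ∑ i ∈ Finset.range N, |f i|, fun n => ?_⟩
  have hs : 0 ≤ ∑ i ∈ Finset.range N, |f i| := Finset.sum_nonneg fun _ _ => abs_nonneg _
  by_cases hn : N ≤ n
  · rw [hf n hn]; linarith
  · have : |f n| ≤ ∑ i ∈ Finset.range N, |f i| :=
      Finset.single_le_sum (f := fun i => |f i|) (fun _ _ => abs_nonneg _)
        (Finset.mem_range.2 (not_le.1 hn))
    linarith [abs_nonneg κ]

theorem arrivalDiff_eq_zero {f : ℕ → ℝ} {N : ℕ} {κ : ℝ} (hf : ∀ n ≥ N, f n = κ) :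
    ∀ n ≥ N, arrivalDiff f n = 0 := fun n hn => by
  rw [arrivalDiff, hf n hn, hf (n + 1) (by omega), sub_self]

theorem departureDiff_eq_zero {μ θ : ℝ} {c : ℕ} {f : ℕ → ℝ} {N : ℕ} {κ : ℝ}
    (hf : ∀ n ≥ N, f n = κ) : ∀ n ≥ N + 1, departureDiff μ θ c f n = 0 := fun n hn => by
  rw [departureDiff, hf n (by omega), hf (n - 1) (by omega), sub_self, mul_zero]

section

variable {Ω : Type*} [mΩ : MeasurableSpace Ω] {P : Measure Ω}
  {ℱ : Filtration ℝ≥0 mΩ} {lam : ℝ → ℝ} {μ θ : ℝ} {c : ℕ} {Q : ℝ≥0 → Ω → ℕ}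

theorem IsErlangA.measurable (hQ : IsErlangA P ℱ lam μ θ c Q) (t : ℝ≥0) : Measurable (Q t) :=
  (hQ.adapted t).mono (ℱ.le t) le_rfl

theorem IsErlangA.measurable_uncurry (hQ : IsErlangA P ℱ lam μ θ c Q) :
    Measurable (fun z : ℝ × Ω => Q z.1.toNNReal z.2) :=
  (measurable_uncurry_of_rightCont hQ.measurable hQ.rightCont).comp
    ((measurable_real_toNNReal.comp measurable_fst).prodMk measurable_snd)

variable [IsProbabilityMeasure P]

theorem IsErlangA.integrable_of_bounded (hQ : IsErlangA P ℱ lam μ θ c Q) {g : ℕ → ℝ} {B : ℝ}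
    (hB : ∀ n, |g n| ≤ B) (t : ℝ≥0) : Integrable (fun ω => g (Q t ω)) P :=
  Integrable.of_bound ((measurable_of_countable g).comp (hQ.measurable t)).aestronglyMeasurable B
    (Eventually.of_forall fun _ => hB _)

theorem IsErlangA.integrable_prod (hQ : IsErlangA P ℱ lam μ θ c Q) {g : ℕ → ℝ} {B : ℝ}
    (hB : ∀ n, |g n| ≤ B) (ν : Measure ℝ) [IsFiniteMeasure ν] :
    Integrable (fun z : ℝ × Ω => g (Q z.1.toNNReal z.2)) (ν.prod P) :=
  Integrable.of_bound ((measurable_of_countable g).comp hQ.measurable_uncurry).aestronglyMeasurable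
    B (Eventually.of_forall fun _ => hB _)

/-- The martingale vanishes at time 0, hence has mean zero at all times; Fubini moves the
expectation inside the time integral. Finite support keeps the unbounded departure rate harmless. -/
theorem IsErlangA.expectAt_eq_of_finite_support (hQ : IsErlangA P ℱ lam μ θ c Q)
    (hlam : Continuous lam) {f : ℕ → ℝ} {N : ℕ} (hf : ∀ n ≥ N, f n = 0) {t : ℝ} (ht : 0 ≤ t) :
    IntervalIntegrable (fun s => lam s * expectAt P Q (arrivalDiff f) s +
      expectAt P Q (departureDiff μ θ c f) s) volume 0 t ∧
    expectAt P Q f t = expectAt P Q f 0 + ∫ s in (0 : ℝ)..t,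
      (lam s * expectAt P Q (arrivalDiff f) s + expectAt P Q (departureDiff μ θ c f) s) := by
  obtain ⟨B, hB⟩ := exists_abs_le_of_eventually_const hf
  obtain ⟨B₁, hB₁⟩ := exists_abs_le_of_eventually_const (arrivalDiff_eq_zero hf)
  obtain ⟨B₂, hB₂⟩ :=
    exists_abs_le_of_eventually_const (departureDiff_eq_zero (μ := μ) (θ := θ) (c := c) hf)
  have hsupp : f.support.Finite := (Finset.range N).finite_toSet.subset fun n hn => by
    by_contra h
    exact hn (hf n (by simpa using h))
  have hmart := hQ.martingale f hsupp
  have hzero := hmart.setIntegral_eq (zero_le (a := t.toNNReal)) MeasurableSet.univ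
  simp only [setIntegral_univ, NNReal.coe_zero, intervalIntegral.integral_same, sub_self,
    integral_zero, Real.coe_toNNReal t ht] at hzero
  obtain ⟨L, hL⟩ := isCompact_Icc.exists_bound_of_continuousOn (s := Icc 0 t) hlam.continuousOn
  have hint : Integrable (fun z : ℝ × Ω => lam z.1 * arrivalDiff f (Q z.1.toNNReal z.2) +
      departureDiff μ θ c f (Q z.1.toNNReal z.2)) ((volume.restrict (Ioc 0 t)).prod P) := by
    refine Integrable.add ?_ (hQ.integrable_prod hB₂ _)
    refine (hQ.integrable_prod hB₁ _).bdd_mul (c := L)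
      (hlam.measurable.comp measurable_fst).aestronglyMeasurable ?_
    have : ∀ᵐ s ∂(volume.restrict (Ioc 0 t)), ‖lam s‖ ≤ L :=
      (ae_restrict_iff' measurableSet_Ioc).2 (Eventually.of_forall fun s hs =>
        hL s (Ioc_subset_Icc_self hs))
    exact Measure.quasiMeasurePreserving_fst.ae this
  have hinner : ∀ s, ∫ ω, (lam s * arrivalDiff f (Q s.toNNReal ω) +
      departureDiff μ θ c f (Q s.toNNReal ω)) ∂P =
      lam s * expectAt P Q (arrivalDiff f) s + expectAt P Q (departureDiff μ θ c f) s := by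
    intro s
    rw [integral_add ((hQ.integrable_of_bounded hB₁ _).const_mul _)
      (hQ.integrable_of_bounded hB₂ _), integral_const_mul, expectAt, expectAt]
  have hswap := integral_integral_swap (f := fun s ω => lam s * arrivalDiff f (Q s.toNNReal ω) +
    departureDiff μ θ c f (Q s.toNNReal ω)) hint
  simp only [hinner] at hswap
  constructor
  · rw [intervalIntegrable_iff_integrableOn_Ioc_of_le ht]
    have := hint.integral_prod_left
    simp only [hinner] at this
    exact this
  · have hI : Integrable (fun ω => ∫ s in (0 : ℝ)..t,
        erlangGenerator lam μ θ c s f (Q s.toNNReal ω)) P := by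
      simp only [intervalIntegral.integral_of_le ht]
      exact hint.integral_prod_right
    rw [integral_sub (f := fun ω => f (Q t.toNNReal ω) - f (Q 0 ω))
      ((hQ.integrable_of_bounded hB _).sub (hQ.integrable_of_bounded hB _)) hI, integral_sub (hQ.integrable_of_bounded hB _) (hQ.integrable_of_bounded hB _)] at hzero
    have hI2 : ∫ ω, (∫ s in (0 : ℝ)..t, erlangGenerator lam μ θ c s f (Q s.toNNReal ω)) ∂P =
        ∫ s in (0 : ℝ)..t, (lam s * expectAt P Q (arrivalDiff f) s +
          expectAt P Q (departureDiff μ θ c f) s) := by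
      simp only [intervalIntegral.integral_of_le ht]
      exact hswap.symm
    rw [hI2] at hzero
    simp only [expectAt, Real.toNNReal_zero] at hzero ⊢
    linarith

theorem IsErlangA.continuousOn_expectAt_of_finite_support (hQ : IsErlangA P ℱ lam μ θ c Q)
    (hlam : Continuous lam) {f : ℕ → ℝ} {N : ℕ} (hf : ∀ n ≥ N, f n = 0) :
    ContinuousOn (expectAt P Q f) (Ici 0) := by
  intro t ht
  -- The longer horizon t + 1 gives continuity at t from both sides within [0, ∞).
  have ht1 : (0 : ℝ) ≤ t + 1 := by have : (0 : ℝ) ≤ t := ht; linarith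
  have h := (hQ.expectAt_eq_of_finite_support hlam hf ht1).1
  have hc := intervalIntegral.continuousOn_primitive_interval'
    h left_mem_uIcc
  rw [uIcc_of_le ht1] at hc
  have hc2 : ContinuousOn (expectAt P Q f) (Icc 0 (t + 1)) :=
    (hc.const_add (expectAt P Q f 0)).congr fun s hs =>
      (hQ.expectAt_eq_of_finite_support hlam hf hs.1).2
  refine (hc2 t ⟨ht, by linarith⟩).mono_of_mem_nhdsWithin ?_
  have : Iio (t + 1) ∈ 𝓝 t := Iio_mem_nhds (by linarith)
  filter_upwards [self_mem_nhdsWithin, mem_nhdsWithin_of_mem_nhds this] with s h1 h2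
  exact ⟨h1, h2.le⟩

theorem IsErlangA.expectAt_eq_of_eventually_const (hQ : IsErlangA P ℱ lam μ θ c Q)
    (hlam : Continuous lam) {f : ℕ → ℝ} {N : ℕ} {κ : ℝ} (hf : ∀ n ≥ N, f n = κ) {t : ℝ}
    (ht : 0 ≤ t) :
    expectAt P Q f t = expectAt P Q f 0 + ∫ s in (0 : ℝ)..t,
      (lam s * expectAt P Q (arrivalDiff f) s + expectAt P Q (departureDiff μ θ c f) s) := by
  obtain ⟨B, hB⟩ := exists_abs_le_of_eventually_const hf
  -- Subtracting κ restores finite support and leaves both difference operators unchanged.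
  have hf' : ∀ n ≥ N, f n - κ = 0 := fun n hn => by rw [hf n hn, sub_self]
  have h := (hQ.expectAt_eq_of_finite_support hlam hf' ht).2
  have e1 : arrivalDiff (fun n => f n - κ) = arrivalDiff f := by
    ext n; simp only [arrivalDiff]; ring
  have e2 : departureDiff μ θ c (fun n => f n - κ) = departureDiff μ θ c f := by
    ext n; simp only [departureDiff]; ring
  have e3 : ∀ s, expectAt P Q (fun n => f n - κ) s = expectAt P Q f s - κ := fun s => by
    simp only [expectAt]
    rw [integral_sub (hQ.integrable_of_bounded hB _) (integrable_const _)]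
    simp
  rw [e1, e2, e3, e3] at h
  linarith

end

theorem hasDerivWithinAt_Icc_of_eq_add_integral {u G : ℝ → ℝ} {T : ℝ}
    (hG : ContinuousOn G (Icc 0 T)) (hu : ∀ t ∈ Icc 0 T, u t = u 0 + ∫ s in (0 : ℝ)..t, G s)
    {t : ℝ} (ht : t ∈ Icc 0 T) : HasDerivWithinAt u (G t) (Icc 0 T) t := by
  have hT : 0 ≤ T := ht.1.trans ht.2
  -- Extending G by its end values makes the two-sided fundamental theorem of calculus available at
  -- 0 and T.
  have hG' : Continuous (fun s => G (projIcc 0 T hT s)) :=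
    hG.comp_continuous (continuous_subtype_val.comp continuous_projIcc)
      (fun s => (projIcc 0 T hT s).2)
  have hd := (intervalIntegral.integral_hasDerivAt_right (hG'.intervalIntegrable 0 t)
    (hG'.stronglyMeasurableAtFilter _ _) hG'.continuousAt).const_add (u 0)
  simp only [projIcc_of_mem hT ht] at hd
  refine hd.hasDerivWithinAt.congr_of_mem (fun s hs => ?_) ht
  rw [hu s hs]
  congr 1
  refine intervalIntegral.integral_congr fun r hr => ?_
  rw [uIcc_of_le hs.1] at hr
  simp only [projIcc_of_mem hT (show r ∈ Icc 0 T from ⟨hr.1, hr.2.trans hs.2⟩)]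

theorem erlangDepartureRate_nonneg {μ θ : ℝ} (hμ : 0 ≤ μ) (hθ : 0 ≤ θ) (c n : ℕ) :
    0 ≤ erlangDepartureRate μ θ c n := by
  unfold erlangDepartureRate; positivity

theorem erlangDepartureRate_le {μ θ : ℝ} (hμ : 0 ≤ μ) (hθ : 0 ≤ θ) (c n : ℕ) :
    erlangDepartureRate μ θ c n ≤ (μ + θ) * n := by
  have h1 : min (n : ℝ) c ≤ n := min_le_left _ _
  have h2 : max ((n : ℝ) - c) 0 ≤ n :=
    max_le (by linarith [Nat.cast_nonneg (α := ℝ) c]) (Nat.cast_nonneg n)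
  unfold erlangDepartureRate
  nlinarith [mul_le_mul_of_nonneg_left h1 hμ, mul_le_mul_of_nonneg_left h2 hθ]

/-- This form separates the linear part, which yields ∂M/∂α, from the concave part, which yields r.
-/
theorem erlangDepartureRate_eq (μ θ x : ℝ) (c : ℕ) :
    erlangDepartureRate μ θ c x = θ * x + (μ - θ) * min x c := by
  unfold erlangDepartureRate
  rcases le_total x c with h | h
  · rw [min_eq_left h, max_eq_right (by linarith)]; ring
  · rw [min_eq_right h, max_eq_left (by linarith)]; ring

/-! ### Exponential test functions and their truncations -/

noncomputable section

/-- `n ↦ e^{α n}`. -/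
def expFun (α : ℝ) (n : ℕ) : ℝ := Real.exp (α * n)

/-- `n ↦ e^{α (n ∧ N)}`. -/
def expMinFun (α : ℝ) (N n : ℕ) : ℝ := Real.exp (α * (min n N : ℕ))

/-- The truncation of `g` to `{0, …, N - 1}`. -/
def truncBelow (g : ℕ → ℝ) (N n : ℕ) : ℝ := if n < N then g n else 0

end

theorem expFun_pos (α : ℝ) (n : ℕ) : 0 < expFun α n := Real.exp_pos _

theorem expMinFun_pos (α : ℝ) (N n : ℕ) : 0 < expMinFun α N n := Real.exp_pos _

theorem abs_truncBelow_le (g : ℕ → ℝ) (N n : ℕ) : |truncBelow g N n| ≤ |g n| := by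
  rw [truncBelow]
  split_ifs <;> simp

theorem truncBelow_eq_zero (g : ℕ → ℝ) (N : ℕ) : ∀ n ≥ N, truncBelow g N n = 0 := fun n hn => by
  rw [truncBelow, if_neg (not_lt.2 hn)]

theorem expMinFun_eventually_const (α : ℝ) (N : ℕ) :
    ∀ n ≥ N, expMinFun α N n = Real.exp (α * N) := fun n hn => by
  rw [expMinFun, min_eq_right hn]

theorem arrivalDiff_expFun (α : ℝ) (n : ℕ) :
    arrivalDiff (expFun α) n = (Real.exp α - 1) * expFun α n := by
  simp only [arrivalDiff, expFun, Nat.cast_add, Nat.cast_one, mul_add, mul_one, Real.exp_add]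
  ring

theorem departureDiff_expFun (μ θ : ℝ) (c : ℕ) (α : ℝ) (n : ℕ) :
    departureDiff μ θ c (expFun α) n =
      (Real.exp (-α) - 1) * (erlangDepartureRate μ θ c n * expFun α n) := by
  -- At n = 0 truncated subtraction makes the left side zero, and the vanishing rate does so on the
  -- right.
  rcases n with _ | n
  · simp [departureDiff, erlangDepartureRate]
  · have : Real.exp (α * ((n : ℝ) + 1)) = Real.exp (α * n) * Real.exp α := by
      rw [← Real.exp_add]; ring_nf
    have h2 : Real.exp (-α) * Real.exp α = 1 := by rw [← Real.exp_add]; simp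
    simp only [departureDiff, expFun, Nat.add_sub_cancel, Nat.cast_add, Nat.cast_one, this]
    linear_combination (-(erlangDepartureRate μ θ c (n + 1) * Real.exp (α * n))) * h2

theorem arrivalDiff_expMinFun (α : ℝ) (N : ℕ) :
    arrivalDiff (expMinFun α N) = truncBelow (arrivalDiff (expFun α)) N := by
  ext n
  simp only [truncBelow, arrivalDiff, expMinFun, expFun]
  split_ifs with h
  · rw [min_eq_left h.le, min_eq_left h]
  · rw [min_eq_right (by omega), min_eq_right (by omega), sub_self]

/-- The cutoff is N + 1, not N as for arrivals: the jump from N to N - 1 still changes n ∧ N, while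
that from N to N + 1 does not. -/
theorem departureDiff_expMinFun (μ θ : ℝ) (c : ℕ) (α : ℝ) (N : ℕ) :
    departureDiff μ θ c (expMinFun α N) = truncBelow (departureDiff μ θ c (expFun α)) (N + 1) := by
  ext n
  simp only [truncBelow, departureDiff, expMinFun, expFun]
  split_ifs with h
  · rw [min_eq_left (by omega), min_eq_left (by omega)]
  · rw [min_eq_right (by omega), min_eq_right (by omega), sub_self, mul_zero]

theorem isLittleO_expFun {α β : ℝ} (h : α < β) (k : ℕ) :
    (fun n : ℕ => (n : ℝ) ^ k * expFun α n) =o[atTop] expFun β := by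
  have h1 := (isLittleO_pow_exp_pos_mul_atTop (k := k) (sub_pos.2 h)).comp_tendsto
    (tendsto_natCast_atTop_atTop (R := ℝ))
  have h2 := h1.mul_isBigO (Asymptotics.isBigO_refl (expFun α) atTop)
  refine h2.congr (fun n => rfl) fun n => ?_
  simp only [Function.comp, expFun, ← Real.exp_add]
  ring_nf

theorem isLittleO_arrivalDiff_expFun {α β : ℝ} (h : α < β) :
    arrivalDiff (expFun α) =o[atTop] expFun β := by
  have := (isLittleO_expFun h 0).const_mul_left (Real.exp α - 1)
  refine this.congr (fun n => ?_) (fun n => rfl)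
  rw [arrivalDiff_expFun]; ring

theorem isLittleO_departureRate_mul_expFun {μ θ : ℝ} (hμ : 0 ≤ μ) (hθ : 0 ≤ θ) (c : ℕ) {α β : ℝ}
    (h : α < β) : (fun n : ℕ => erlangDepartureRate μ θ c n * expFun α n) =o[atTop] expFun β := by
  refine Asymptotics.IsBigO.trans_isLittleO ?_ (isLittleO_expFun h 1)
  refine Asymptotics.IsBigO.of_bound (μ + θ) (Eventually.of_forall fun n => ?_)
  rw [Real.norm_of_nonneg (mul_nonneg (erlangDepartureRate_nonneg hμ hθ c n) (expFun_pos _ _).le),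
    Real.norm_of_nonneg (mul_nonneg (by positivity) (expFun_pos _ _).le), pow_one, ← mul_assoc]
  exact mul_le_mul_of_nonneg_right (erlangDepartureRate_le hμ hθ c n) (expFun_pos _ _).le

theorem isLittleO_departureDiff_expFun {μ θ : ℝ} (hμ : 0 ≤ μ) (hθ : 0 ≤ θ) (c : ℕ) {α β : ℝ}
    (h : α < β) : departureDiff μ θ c (expFun α) =o[atTop] expFun β := by
  refine ((isLittleO_departureRate_mul_expFun hμ hθ c h).const_mul_left
    (Real.exp (-α) - 1)).congr (fun n => ?_) (fun n => rfl)
  rw [departureDiff_expFun]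

theorem exists_abs_le_of_isLittleO {g : ℕ → ℝ} {β : ℝ} (hg : g =o[atTop] expFun β) :
    ∃ A, 0 ≤ A ∧ ∀ n, |g n| ≤ A * expFun β n := by
  obtain ⟨A, hA, h⟩ := Asymptotics.bound_of_isBigO_nat_atTop hg.isBigO
  refine ⟨A, hA.le, fun n => ?_⟩
  have := h (x := n) (expFun_pos _ _).ne'
  rwa [Real.norm_eq_abs, Real.norm_of_nonneg (expFun_pos _ _).le] at this

/-! ### Exponential moments and the forward equation for exponentials -/

section

variable {Ω : Type*} [mΩ : MeasurableSpace Ω] {P : Measure Ω} [IsProbabilityMeasure P]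
  {ℱ : Filtration ℝ≥0 mΩ} {lam : ℝ → ℝ} {μ θ : ℝ} {c : ℕ} {Q : ℝ≥0 → Ω → ℕ}

omit [IsProbabilityMeasure P] in
theorem IsErlangA.aestronglyMeasurable (hQ : IsErlangA P ℱ lam μ θ c Q) (g : ℕ → ℝ) (t : ℝ≥0) :
    AEStronglyMeasurable (fun ω => g (Q t ω)) P :=
  ((measurable_of_countable g).comp (hQ.measurable t)).aestronglyMeasurable

omit [IsProbabilityMeasure P] in
theorem IsErlangA.integrable_of_abs_le (hQ : IsErlangA P ℱ lam μ θ c Q) {g : ℕ → ℝ} {A β : ℝ}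
    (hA : ∀ n, |g n| ≤ A * expFun β n) {t : ℝ≥0} (h : Integrable (fun ω => expFun β (Q t ω)) P) :
    Integrable (fun ω => g (Q t ω)) P :=
  (h.const_mul A).mono' (hQ.aestronglyMeasurable g t)
    (Eventually.of_forall fun _ => hA _)

omit [IsProbabilityMeasure P] in
theorem IsErlangA.abs_expectAt_le (hQ : IsErlangA P ℱ lam μ θ c Q) {g : ℕ → ℝ} {A β C t : ℝ}
    (hA0 : 0 ≤ A) (hA : ∀ n, |g n| ≤ A * expFun β n)
    (h : Integrable (fun ω => expFun β (Q t.toNNReal ω)) P) (hC : expectAt P Q (expFun β) t ≤ C) :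
    |expectAt P Q g t| ≤ A * C := by
  refine (abs_integral_le_integral_abs).trans ?_
  refine (integral_mono (hQ.integrable_of_abs_le hA h).abs (h.const_mul A)
    (fun ω => hA _)).trans ?_
  rw [integral_const_mul]
  exact mul_le_mul_of_nonneg_left hC hA0

/-- For α ≥ 0 departures only lower e^{α(n ∧ N)} and arrivals raise it at relative rate at most
λ(e^α - 1). Grönwall's bound is therefore uniform in N, and monotone convergence removes N. -/
theorem IsErlangA.exp_moment_bound (hQ : IsErlangA P ℱ lam μ θ c Q) (hμ : 0 ≤ μ) (hθ : 0 ≤ θ)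
    (hlam : Continuous lam) (hlam0 : ∀ t, 0 ≤ t → 0 ≤ lam t) {α : ℝ} (hα : 0 ≤ α)
    (h0 : Integrable (fun ω => expFun α (Q 0 ω)) P) (T : ℝ) :
    ∃ C, ∀ t ∈ Icc 0 T, Integrable (fun ω => expFun α (Q t.toNNReal ω)) P ∧
      expectAt P Q (expFun α) t ≤ C := by
  obtain ⟨L, hL⟩ := isCompact_Icc.exists_bound_of_continuousOn (s := Icc 0 T) hlam.continuousOn
  -- `|L|` is used because L may be negative when [0,T] is empty.
  have hL' : ∀ t ∈ Icc 0 T, lam t ≤ |L| := fun t ht =>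
    ((le_abs_self _).trans (hL t ht)).trans (le_abs_self L)
  have hexp : 0 ≤ Real.exp α - 1 := by linarith [Real.add_one_le_exp α]
  set K := |L| * (Real.exp α - 1) with hK
  have hK0 : 0 ≤ K := by positivity
  set m := expectAt P Q (expFun α) 0 with hm
  have hint : ∀ N (t : ℝ≥0), Integrable (fun ω => expMinFun α N (Q t ω)) P := fun N t => by
    obtain ⟨B, hB⟩ := exists_abs_le_of_eventually_const (expMinFun_eventually_const α N)
    exact hQ.integrable_of_bounded hB t
  have hbound : ∀ N, ∀ t ∈ Icc 0 T, expectAt P Q (expMinFun α N) t ≤ m * Real.exp (K * t) := by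
    intro N t ht
    have hG1 := truncBelow_eq_zero (arrivalDiff (expFun α)) N
    have hG2 := truncBelow_eq_zero (departureDiff μ θ c (expFun α)) (N + 1)
    have hGc : ContinuousOn (fun s => lam s * expectAt P Q (arrivalDiff (expMinFun α N)) s +
        expectAt P Q (departureDiff μ θ c (expMinFun α N)) s) (Icc 0 T) := by
      rw [arrivalDiff_expMinFun, departureDiff_expMinFun]
      exact ((hlam.continuousOn.mul (hQ.continuousOn_expectAt_of_finite_support hlam hG1)).add
        (hQ.continuousOn_expectAt_of_finite_support hlam hG2)).mono Icc_subset_Ici_self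
    have hder : ∀ s ∈ Icc 0 T, _ := fun s hs => hasDerivWithinAt_Icc_of_eq_add_integral hGc
      (fun r hr => hQ.expectAt_eq_of_eventually_const hlam (expMinFun_eventually_const α N) hr.1) hs
    have hexpd : ∀ s, HasDerivAt (fun s => m * Real.exp (K * s)) (m * (Real.exp (K * s) * K)) s :=
      fun s => by simpa using (((hasDerivAt_id s).const_mul K).exp).const_mul m
    have hGle : ∀ s ∈ Icc 0 T, lam s * expectAt P Q (arrivalDiff (expMinFun α N)) s +
        expectAt P Q (departureDiff μ θ c (expMinFun α N)) s ≤
        K * expectAt P Q (expMinFun α N) s := by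
      intro s hs
      have e1 : expectAt P Q (departureDiff μ θ c (expMinFun α N)) s ≤ 0 := by
        refine integral_nonpos fun ω => ?_
        refine mul_nonpos_of_nonneg_of_nonpos (erlangDepartureRate_nonneg hμ hθ c _) ?_
        refine sub_nonpos.2 (Real.exp_le_exp.2 (mul_le_mul_of_nonneg_left ?_ hα))
        exact_mod_cast min_le_min_right N (Nat.sub_le _ 1)
      have e2 : expectAt P Q (arrivalDiff (expMinFun α N)) s ≤
          (Real.exp α - 1) * expectAt P Q (expMinFun α N) s := by
        unfold expectAt
        rw [← integral_const_mul]
        obtain ⟨B, hB⟩ := exists_abs_le_of_eventually_const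
          (arrivalDiff_eq_zero (expMinFun_eventually_const α N))
        refine integral_mono (hQ.integrable_of_bounded hB _) ((hint N _).const_mul _) fun ω => ?_
        simp only [arrivalDiff_expMinFun, truncBelow, arrivalDiff_expFun]
        split_ifs with h
        · rw [expMinFun, expFun, min_eq_left h.le]
        · exact mul_nonneg hexp (expFun_pos _ _).le
      have e3 : 0 ≤ expectAt P Q (expMinFun α N) s := integral_nonneg fun ω => (expMinFun_pos _ _ _).le
      calc _ ≤ lam s * ((Real.exp α - 1) * expectAt P Q (expMinFun α N) s) + 0 :=
            add_le_add (mul_le_mul_of_nonneg_left e2 (hlam0 s hs.1)) e1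
        _ ≤ |L| * ((Real.exp α - 1) * expectAt P Q (expMinFun α N) s) := by
            rw [add_zero]
            exact mul_le_mul_of_nonneg_right (hL' s hs) (mul_nonneg hexp e3)
        _ = _ := by rw [hK]; ring
    -- Grönwall's inequality is the maximum principle over a one-point space.
    have hmax := nonpos_of_deriv_le_at_spatial_max (X := Unit) (S := univ) isCompact_univ
      (T := T) (K := K) (w := fun s _ => expectAt P Q (expMinFun α N) s - m * Real.exp (K * s))
      ?_ ?_ ?_ t ht () (mem_univ _)
    · linarith
    · refine ContinuousOn.comp (g := fun s => expectAt P Q (expMinFun α N) s - m * Real.exp (K * s))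
        (t := Icc 0 T) ?_ continuousOn_fst (fun z hz => hz.1)
      exact fun s hs => ((hder s hs).continuousWithinAt).sub
        (hexpd s).continuousAt.continuousWithinAt
    · intro _ _
      simp only [mul_zero, Real.exp_zero, mul_one, sub_nonpos, hm]
      refine integral_mono (hint N _) (by simpa using h0) fun ω => ?_
      refine Real.exp_le_exp.2 (mul_le_mul_of_nonneg_left ?_ hα)
      exact_mod_cast min_le_left _ _
    · intro s hs _ _ _ _
      have hs' : s ∈ Icc 0 T := ⟨hs.1.le, hs.2⟩
      refine ⟨_, (hder s hs').sub (hexpd s).hasDerivWithinAt, ?_⟩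
      have := hGle s hs'
      linarith
  have hm0 : 0 ≤ m := integral_nonneg fun ω => (expFun_pos _ _).le
  refine ⟨m * Real.exp (K * T), fun t ht => ?_⟩
  have hbd : ∀ N, ∫ ω, expMinFun α N (Q t.toNNReal ω) ∂P ≤ m * Real.exp (K * T) := fun N =>
    (hbound N t ht).trans (mul_le_mul_of_nonneg_left (Real.exp_le_exp.2
      (mul_le_mul_of_nonneg_left ht.2 hK0)) hm0)
  have hmono : ∀ ω, Monotone fun N => expMinFun α N (Q t.toNNReal ω) := fun ω N N' hN =>
    Real.exp_le_exp.2 (mul_le_mul_of_nonneg_left (by exact_mod_cast min_le_min_left _ hN) hα)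
  have hlim : ∀ ω, Tendsto (fun N => expMinFun α N (Q t.toNNReal ω)) atTop
      (𝓝 (expFun α (Q t.toNNReal ω))) := fun ω => by
    refine tendsto_const_nhds.congr' ?_
    filter_upwards [eventually_ge_atTop (Q t.toNNReal ω)] with N hN
    rw [expMinFun, expFun, min_eq_left hN]
  have hlint : ∫⁻ ω, ENNReal.ofReal (expFun α (Q t.toNNReal ω)) ∂P ≤
      ENNReal.ofReal (m * Real.exp (K * T)) := by
    have h1 := lintegral_tendsto_of_tendsto_of_monotone (μ := P)
      (f := fun N ω => ENNReal.ofReal (expMinFun α N (Q t.toNNReal ω)))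
      (F := fun ω => ENNReal.ofReal (expFun α (Q t.toNNReal ω)))
      (fun N => (hint N _).1.aemeasurable.ennreal_ofReal)
      (Eventually.of_forall fun ω N N' hN => ENNReal.ofReal_le_ofReal (hmono ω hN))
      (Eventually.of_forall fun ω => (ENNReal.continuous_ofReal.tendsto _).comp (hlim ω))
    refine le_of_tendsto h1 (Eventually.of_forall fun N => ?_)
    rw [← ofReal_integral_eq_lintegral_ofReal (hint N _)
      (Eventually.of_forall fun ω => (expMinFun_pos _ _ _).le)]
    exact ENNReal.ofReal_le_ofReal (hbd N)
  have hi : Integrable (fun ω => expFun α (Q t.toNNReal ω)) P := by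
    refine ⟨hQ.aestronglyMeasurable _ _, ?_⟩
    rw [hasFiniteIntegral_iff_ofReal (Eventually.of_forall fun ω => (expFun_pos _ _).le)]
    exact hlint.trans_lt ENNReal.ofReal_lt_top
  refine ⟨hi, ?_⟩
  rw [← ofReal_integral_eq_lintegral_ofReal hi
    (Eventually.of_forall fun ω => (expFun_pos _ _).le)] at hlint
  exact (ENNReal.ofReal_le_ofReal_iff (by positivity)).1 hlint

-- The tail of g is at most ε e^{βn}, and the β-moment is bounded uniformly in time. Uniformity lets
-- continuity in time pass to the limit.
omit [IsProbabilityMeasure P] in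
theorem IsErlangA.tendstoUniformlyOn_expectAt_truncBelow (hQ : IsErlangA P ℱ lam μ θ c Q)
    {g : ℕ → ℝ} {β C T : ℝ} (hg : g =o[atTop] expFun β)
    (hC : ∀ t ∈ Icc 0 T, Integrable (fun ω => expFun β (Q t.toNNReal ω)) P ∧
      expectAt P Q (expFun β) t ≤ C) :
    TendstoUniformlyOn (fun N => expectAt P Q (truncBelow g N)) (expectAt P Q g) atTop
      (Icc 0 T) := by
  obtain ⟨A, hA0, hA⟩ := exists_abs_le_of_isLittleO hg
  rw [Metric.tendstoUniformlyOn_iff]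
  intro ε hε
  have hδ : 0 < ε / (|C| + 1) := by positivity
  obtain ⟨N₀, hN₀⟩ := eventually_atTop.1 (hg.bound hδ)
  filter_upwards [eventually_ge_atTop N₀] with N hN t ht
  have htr : ∀ n, |truncBelow g N n| ≤ A * expFun β n := fun n =>
    (abs_truncBelow_le g N n).trans (hA n)
  have hdiff : expectAt P Q g t - expectAt P Q (truncBelow g N) t =
      expectAt P Q (fun n => g n - truncBelow g N n) t := by
    simp only [expectAt]
    rw [integral_sub (hQ.integrable_of_abs_le hA (hC t ht).1)
      (hQ.integrable_of_abs_le htr (hC t ht).1)]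
  rw [Real.dist_eq, hdiff]
  refine (hQ.abs_expectAt_le (β := β) hδ.le (fun n => ?_) (hC t ht).1 (hC t ht).2).trans_lt ?_
  · rw [truncBelow]
    split_ifs with h
    · rw [sub_self, abs_zero]
      exact mul_nonneg hδ.le (expFun_pos _ _).le
    · have := hN₀ n (hN.trans (not_lt.1 h))
      rwa [Real.norm_eq_abs, Real.norm_of_nonneg (expFun_pos _ _).le, ← sub_zero (g n)] at this
  · rw [div_mul_eq_mul_div, div_lt_iff₀ (by positivity)]
    nlinarith [le_abs_self C]

theorem IsErlangA.continuousOn_expectAt (hQ : IsErlangA P ℱ lam μ θ c Q) (hlam : Continuous lam)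
    {g : ℕ → ℝ} {β C T : ℝ} (hg : g =o[atTop] expFun β)
    (hC : ∀ t ∈ Icc 0 T, Integrable (fun ω => expFun β (Q t.toNNReal ω)) P ∧
      expectAt P Q (expFun β) t ≤ C) : ContinuousOn (expectAt P Q g) (Icc 0 T) :=
  (hQ.tendstoUniformlyOn_expectAt_truncBelow hg hC).continuousOn
    (Eventually.of_forall fun N => (hQ.continuousOn_expectAt_of_finite_support hlam
      (truncBelow_eq_zero g N)).mono Icc_subset_Ici_self).frequently

/-- The forward equation for exponential test functions. -/
theorem IsErlangA.hasDerivWithinAt_expectAt_expFun (hQ : IsErlangA P ℱ lam μ θ c Q) (hμ : 0 ≤ μ)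
    (hθ : 0 ≤ θ) (hlam : Continuous lam) {α β C T : ℝ} (hαβ : α < β)
    (hC : ∀ t ∈ Icc 0 T, Integrable (fun ω => expFun β (Q t.toNNReal ω)) P ∧
      expectAt P Q (expFun β) t ≤ C) {t : ℝ} (ht : t ∈ Icc 0 T) :
    HasDerivWithinAt (expectAt P Q (expFun α))
      (lam t * expectAt P Q (arrivalDiff (expFun α)) t +
        expectAt P Q (departureDiff μ θ c (expFun α)) t) (Icc 0 T) t := by
  have o0 : expFun α =o[atTop] expFun β := by simpa using isLittleO_expFun hαβ 0
  have o1 := isLittleO_arrivalDiff_expFun hαβ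
  have o2 := isLittleO_departureDiff_expFun hμ hθ c hαβ
  have c1 := hQ.continuousOn_expectAt hlam o1 hC
  have c2 := hQ.continuousOn_expectAt hlam o2 hC
  refine hasDerivWithinAt_Icc_of_eq_add_integral (u := expectAt P Q (expFun α))
    (G := fun t => lam t * expectAt P Q (arrivalDiff (expFun α)) t +
        expectAt P Q (departureDiff μ θ c (expFun α)) t)
    ((hlam.continuousOn.mul c1).add c2) ?_ ht
  clear t ht
  intro t ht
  obtain ⟨A₁, hA₁0, hA₁⟩ := exists_abs_le_of_isLittleO o1
  obtain ⟨A₂, hA₂0, hA₂⟩ := exists_abs_le_of_isLittleO o2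
  obtain ⟨A₀, hA₀0, hA₀⟩ := exists_abs_le_of_isLittleO o0
  obtain ⟨L, hL⟩ := isCompact_Icc.exists_bound_of_continuousOn (s := Icc 0 T) hlam.continuousOn
  have htr : ∀ {g : ℕ → ℝ} {A : ℝ}, (∀ n, |g n| ≤ A * expFun β n) → ∀ N n,
      |truncBelow g N n| ≤ A * expFun β n := fun hA N n => (abs_truncBelow_le _ N n).trans (hA n)
  have hlim : ∀ s ∈ Icc 0 T, Tendsto (fun N => expectAt P Q (expMinFun α N) s) atTop
      (𝓝 (expectAt P Q (expFun α) s)) := by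
    intro s hs
    refine tendsto_integral_of_dominated_convergence
      -- The dominating function serves both signs of α: the truncated exponential is at most e^{αQ}
      -- if α ≥ 0 and at most 1 if α ≤ 0.
      (fun ω => 1 + expFun α (Q s.toNNReal ω)) (fun N =>
        hQ.aestronglyMeasurable _ _)
      ((integrable_const _).add (hQ.integrable_of_abs_le hA₀ (hC s hs).1)) ?_ ?_
    · refine fun N => Eventually.of_forall fun ω => ?_
      rw [Real.norm_of_nonneg (expMinFun_pos _ _ _).le, expMinFun, expFun]
      rcases le_total 0 α with h | h
      · have : Real.exp (α * (min (Q s.toNNReal ω) N : ℕ)) ≤ Real.exp (α * (Q s.toNNReal ω)) :=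
          Real.exp_le_exp.2 (mul_le_mul_of_nonneg_left (by exact_mod_cast min_le_left _ _) h)
        linarith
      · have : Real.exp (α * (min (Q s.toNNReal ω) N : ℕ)) ≤ 1 :=
          Real.exp_le_one_iff.2 (mul_nonpos_of_nonpos_of_nonneg h (by positivity))
        linarith [Real.exp_pos (α * (Q s.toNNReal ω))]
    · refine Eventually.of_forall fun ω => tendsto_const_nhds.congr' ?_
      filter_upwards [eventually_ge_atTop (Q s.toNNReal ω)] with N hN
      rw [expMinFun, expFun, min_eq_left hN]
  have hI : Tendsto (fun N => ∫ s in (0 : ℝ)..t,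
      (lam s * expectAt P Q (arrivalDiff (expMinFun α N)) s +
        expectAt P Q (departureDiff μ θ c (expMinFun α N)) s)) atTop
      (𝓝 (∫ s in (0 : ℝ)..t, (lam s * expectAt P Q (arrivalDiff (expFun α)) s +
        expectAt P Q (departureDiff μ θ c (expFun α)) s))) := by
    simp only [arrivalDiff_expMinFun, departureDiff_expMinFun]
    have hsub : ∀ s ∈ uIoc 0 t, s ∈ Icc 0 T := fun s hs => by
      rw [uIoc_of_le ht.1] at hs
      exact ⟨hs.1.le, hs.2.trans ht.2⟩
    refine intervalIntegral.tendsto_integral_filter_of_dominated_convergence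
      (fun _ => |L| * (A₁ * C) + A₂ * C) ?_ ?_ intervalIntegrable_const ?_
    · refine Eventually.of_forall fun N => ContinuousOn.aestronglyMeasurable ?_ measurableSet_uIoc
      exact ((hlam.continuousOn.mul (hQ.continuousOn_expectAt_of_finite_support hlam
        (truncBelow_eq_zero _ N))).add (hQ.continuousOn_expectAt_of_finite_support hlam
        (truncBelow_eq_zero _ (N + 1)))).mono fun s hs => (hsub s hs).1
    · refine Eventually.of_forall fun N => Eventually.of_forall fun s hs => ?_
      have hs' := hsub s hs
      have b1 := hQ.abs_expectAt_le hA₁0 (htr hA₁ N) (hC s hs').1 (hC s hs').2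
      have b2 := hQ.abs_expectAt_le hA₂0 (htr hA₂ (N + 1)) (hC s hs').1 (hC s hs').2
      refine (norm_add_le _ _).trans (add_le_add ?_ b2)
      rw [norm_mul]
      exact mul_le_mul ((hL s hs').trans (le_abs_self L)) b1 (norm_nonneg _) (abs_nonneg _)
    · refine Eventually.of_forall fun s hs => ?_
      have hs' := hsub s hs
      exact (((hQ.tendstoUniformlyOn_expectAt_truncBelow o1 hC).tendsto_at hs').const_mul _).add
        (((hQ.tendstoUniformlyOn_expectAt_truncBelow o2 hC).tendsto_at hs').comp
          (tendsto_add_atTop_nat 1))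
  have h1 := hlim t ht
  have h2 := (hlim 0 ⟨le_rfl, ht.1.trans ht.2⟩).add hI
  refine tendsto_nhds_unique h1 (h2.congr fun N => ?_)
  exact (hQ.expectAt_eq_of_eventually_const hlam (expMinFun_eventually_const α N) ht.1).symm

end

/-! ### The moment generating function: regularity and evolution -/

section

variable {Ω : Type*} [mΩ : MeasurableSpace Ω] {P : Measure Ω}
  {ℱ : Filtration ℝ≥0 mΩ} {lam : ℝ → ℝ} {μ θ : ℝ} {c : ℕ} {Q : ℝ≥0 → Ω → ℕ}

/-- Allows the arrival rate to be replaced by an extension that is continuous on all of ℝ. -/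
theorem IsErlangA.congr_rate {lam' : ℝ → ℝ} (hQ : IsErlangA P ℱ lam μ θ c Q)
    (h : ∀ t, 0 ≤ t → lam' t = lam t) : IsErlangA P ℱ lam' μ θ c Q where
  adapted := hQ.adapted
  rightCont := hQ.rightCont
  leftLim := hQ.leftLim
  martingale f hf := by
    convert hQ.martingale f hf using 4 with t ω
    refine intervalIntegral.integral_congr fun s hs => ?_
    rw [uIcc_of_le t.coe_nonneg] at hs
    simp only [erlangGenerator, h s hs.1]

theorem IsFluidMGF.congr_rate {lam' : ℝ → ℝ} {T : ℝ} {J : Set ℝ} {M : ℝ → ℝ → ℝ}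
    (hM : IsFluidMGF lam μ θ c T J M) (h : ∀ t, 0 ≤ t → lam' t = lam t) :
    IsFluidMGF lam' μ θ c T J M where
  pos := hM.pos
  cont := hM.cont
  pde t ht α hα := by simpa only [h t ht.1] using hM.pde t ht α hα

/-- Every term of the equation carries a factor e^{±α} - 1, which vanishes at α = 0. This replaces a
boundary condition there. -/
theorem IsFluidMGF.eq_initial_at_zero {T : ℝ} {J : Set ℝ} {M : ℝ → ℝ → ℝ}
    (hM : IsFluidMGF lam μ θ c T J M) (hJ : (0 : ℝ) ∈ J) {t : ℝ} (ht : t ∈ Icc 0 T) :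
    M t 0 = M 0 0 := by
  have hd : ∀ s ∈ Icc 0 T, HasDerivWithinAt (fun s => M s 0) 0 (Icc 0 T) s := fun s hs => by
    obtain ⟨p, -, h⟩ := hM.pde s hs 0 hJ
    simpa using h
  exact constant_of_has_deriv_right_zero (f := fun s => M s 0)
    (fun s hs => (hd s hs).continuousWithinAt)
    (fun s hs => (hd s ⟨hs.1, hs.2.le⟩).mono_of_mem_nhdsWithin (Icc_mem_nhdsGE_of_mem hs)) t ht

theorem IsErlangA.integrable_expFun_of_le (hQ : IsErlangA P ℱ lam μ θ c Q) {α β : ℝ}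
    (hαβ : α ≤ β) {t : ℝ≥0} (h : Integrable (fun ω => expFun β (Q t ω)) P) :
    Integrable (fun ω => expFun α (Q t ω)) P :=
  hQ.integrable_of_abs_le (A := 1) (fun n => by
    rw [abs_of_pos (expFun_pos _ _), one_mul]
    exact Real.exp_le_exp.2 (mul_le_mul_of_nonneg_right hαβ n.cast_nonneg)) h

theorem IsErlangA.monotoneOn_expectAt_expFun (hQ : IsErlangA P ℱ lam μ θ c Q) {β t : ℝ}
    (h : Integrable (fun ω => expFun β (Q t.toNNReal ω)) P) :
    MonotoneOn (fun α => expectAt P Q (expFun α) t) (Iic β) := fun _ ha _ hb hab =>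
  integral_mono (hQ.integrable_expFun_of_le ha h) (hQ.integrable_expFun_of_le hb h) fun _ =>
    Real.exp_le_exp.2 (mul_le_mul_of_nonneg_right hab (Nat.cast_nonneg _))

theorem IsErlangA.continuousOn_expectAt_expFun (hQ : IsErlangA P ℱ lam μ θ c Q) {β t : ℝ}
    (h : Integrable (fun ω => expFun β (Q t.toNNReal ω)) P) :
    ContinuousOn (fun α => expectAt P Q (expFun α) t) (Iic β) := by
  refine continuousOn_of_dominated (bound := fun ω => expFun β (Q t.toNNReal ω))
    (fun α _ => hQ.aestronglyMeasurable _ _) (fun α hα => Eventually.of_forall fun ω => ?_) h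
    (Eventually.of_forall fun ω => ?_)
  · rw [Real.norm_of_nonneg (expFun_pos _ _).le]
    exact Real.exp_le_exp.2 (mul_le_mul_of_nonneg_right hα (Nat.cast_nonneg _))
  · unfold expFun
    fun_prop

variable [IsProbabilityMeasure P]

/-- The moment generating function of the Erlang-A queue solves the fluid equation with
`min p (c M)` replaced by the smaller quantity `r = E[(Q ∧ c) e^{αQ}]`. -/
theorem IsErlangA.exists_hasDeriv_expectAt_expFun (hQ : IsErlangA P ℱ lam μ θ c Q) (hμ : 0 ≤ μ)
    (hθ : 0 ≤ θ) (hlam : Continuous lam) {α β C T : ℝ} (hαβ : α < β)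
    (hC : ∀ t ∈ Icc 0 T, Integrable (fun ω => expFun β (Q t.toNNReal ω)) P ∧
      expectAt P Q (expFun β) t ≤ C) {t : ℝ} (ht : t ∈ Icc 0 T) :
    ∃ p r, HasDerivAt (fun a => expectAt P Q (expFun a) t) p α ∧
      HasDerivWithinAt (fun s => expectAt P Q (expFun α) s)
        (lam t * (Real.exp α - 1) * expectAt P Q (expFun α) t +
          (Real.exp (-α) - 1) * (θ * p + (μ - θ) * r)) (Icc 0 T) t ∧
      r ≤ p ∧ r ≤ c * expectAt P Q (expFun α) t := by
  have hβ := (hC t ht).1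
  have hp : Integrable (fun ω => (Q t.toNNReal ω : ℝ) * expFun α (Q t.toNNReal ω)) P := by
    obtain ⟨A, -, hA⟩ := exists_abs_le_of_isLittleO (isLittleO_expFun hαβ 1)
    simpa only [pow_one] using hQ.integrable_of_abs_le hA hβ
  have h1 := hQ.integrable_expFun_of_le hαβ.le hβ
  have hr : Integrable (fun ω => min (Q t.toNNReal ω : ℝ) c * expFun α (Q t.toNNReal ω)) P := by
    refine hp.mono' (hQ.aestronglyMeasurable (fun n => min (n : ℝ) c * expFun α n) _)
      (Eventually.of_forall fun ω => ?_)
    rw [Real.norm_of_nonneg (mul_nonneg (by positivity) (expFun_pos _ _).le)]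
    exact mul_le_mul_of_nonneg_right (min_le_left _ _) (expFun_pos _ _).le
  have hint : α ∈ interior (integrableExpSet (fun ω => (Q t.toNNReal ω : ℝ)) P) :=
    mem_interior.2 ⟨Iio β, fun a (ha : a < β) => hQ.integrable_expFun_of_le ha.le hβ,
      isOpen_Iio, hαβ⟩
  refine ⟨∫ ω, (Q t.toNNReal ω : ℝ) * expFun α (Q t.toNNReal ω) ∂P,
    ∫ ω, min (Q t.toNNReal ω : ℝ) c * expFun α (Q t.toNNReal ω) ∂P, hasDerivAt_mgf hint, ?_,
    integral_mono hr hp fun ω =>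
      mul_le_mul_of_nonneg_right (min_le_left _ _) (expFun_pos _ _).le, ?_⟩
  · convert hQ.hasDerivWithinAt_expectAt_expFun hμ hθ hlam hαβ hC ht using 1
    have e1 : expectAt P Q (arrivalDiff (expFun α)) t =
        (Real.exp α - 1) * expectAt P Q (expFun α) t := by
      simp only [expectAt, arrivalDiff_expFun, integral_const_mul]
    have e2 : expectAt P Q (departureDiff μ θ c (expFun α)) t = (Real.exp (-α) - 1) *
        (θ * ∫ ω, (Q t.toNNReal ω : ℝ) * expFun α (Q t.toNNReal ω) ∂P + (μ - θ) *
          ∫ ω, min (Q t.toNNReal ω : ℝ) c * expFun α (Q t.toNNReal ω) ∂P) := by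
      simp only [expectAt, departureDiff_expFun, integral_const_mul, erlangDepartureRate_eq,
        add_mul, mul_assoc]
      rw [integral_add (hp.const_mul _) (hr.const_mul _), integral_const_mul, integral_const_mul]
    rw [e1, e2, mul_assoc]
  · rw [expectAt, ← integral_const_mul]
    exact integral_mono hr (h1.const_mul _) fun ω =>
      mul_le_mul_of_nonneg_right (min_le_right _ _) (expFun_pos _ _).le

theorem IsErlangA.expectAt_expFun_zero (t : ℝ) : expectAt P Q (expFun 0) t = 1 := by
  simp [expectAt, expFun]

end

/-! ### Comparison with the fluid equation -/

/-- If the minimum is pf, then r ≤ p ≤ pf; if it is c·mf, then r ≤ c·m leaves an error of order |m -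
mf|. The derivative difference p - pf drops out by its sign. -/
theorem departure_gap_le {μ θ c m mf p pf r : ℝ} (hθ : 0 ≤ θ) (hc : 0 ≤ c) (h : θ ≤ μ)
    (hp : p ≤ pf) (hr : r ≤ p) (hrc : r ≤ c * m) :
    θ * (p - pf) + (μ - θ) * (r - min pf (c * mf)) ≤ |θ - μ| * c * |m - mf| := by
  have h1 : r - min pf (c * mf) ≤ c * |m - mf| := by
    rcases min_choice pf (c * mf) with e | e <;> rw [e]
    · nlinarith [mul_nonneg hc (abs_nonneg (m - mf))]
    · nlinarith [mul_le_mul_of_nonneg_left (le_abs_self (m - mf)) hc]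
  rw [abs_of_nonpos (sub_nonpos.2 h)]
  nlinarith [mul_le_mul_of_nonneg_left h1 (sub_nonneg.2 h),
    mul_nonneg hθ (sub_nonneg.2 hp)]

/-- Here r may exceed pf, but by at most p - pf. The term θ(p - pf) absorbs this excess, leaving μ(p
- pf) ≥ 0. -/
theorem le_departure_gap {μ θ c m mf p pf r : ℝ} (hμ : 0 ≤ μ) (hc : 0 ≤ c) (h : μ ≤ θ)
    (hp : pf ≤ p) (hr : r ≤ p) (hrc : r ≤ c * m) :
    -(|θ - μ| * c * |m - mf|) ≤ θ * (p - pf) + (μ - θ) * (r - min pf (c * mf)) := by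
  rw [abs_of_nonneg (sub_nonneg.2 h)]
  have h0 : 0 ≤ (θ - μ) * (c * |m - mf|) :=
    mul_nonneg (sub_nonneg.2 h) (mul_nonneg hc (abs_nonneg _))
  rcases min_choice pf (c * mf) with e | e <;> rw [e]
  · nlinarith [mul_le_mul_of_nonneg_left hr (sub_nonneg.2 h), mul_nonneg hμ (sub_nonneg.2 hp)]
  · have h1 : r - c * mf ≤ c * |m - mf| := by
      nlinarith [mul_le_mul_of_nonneg_left (le_abs_self (m - mf)) hc]
    nlinarith [mul_le_mul_of_nonneg_left h1 (sub_nonneg.2 h),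
      mul_nonneg (hμ.trans h) (sub_nonneg.2 hp)]

/-- Comparison of a sub- or supersolution with the fluid moment generating function. The
alternative `hside` says that the flow of the equation leaves `S` at its end points. -/
theorem fluid_comparison {lam : ℝ → ℝ} {μ θ T σ : ℝ} {c : ℕ} {S : Set ℝ} {M Mf : ℝ → ℝ → ℝ}
    (hlam : Continuous lam) (hμ : 0 ≤ μ) (hθ : 0 ≤ θ) (hS : IsCompact S) (hσ : |σ| = 1)
    (hMf : IsFluidMGF lam μ θ c T S Mf)
    (hcont : ContinuousOn (fun z : ℝ × ℝ => M z.1 z.2) (Icc 0 T ×ˢ S))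
    (hinit : ∀ α ∈ S, M 0 α = Mf 0 α) (hzero : ∀ t ∈ Icc 0 T, M t 0 = Mf t 0)
    (hM : ∀ t ∈ Icc 0 T, ∀ α ∈ S, α ≠ 0 → ∃ p r, HasDerivWithinAt (M t) p S α ∧
      HasDerivWithinAt (fun s => M s α) (lam t * (Real.exp α - 1) * M t α +
        (Real.exp (-α) - 1) * (θ * p + (μ - θ) * r)) (Icc 0 T) t ∧ r ≤ p ∧ r ≤ c * M t α)
    (hside : ∀ f : ℝ → ℝ, ∀ d, ∀ α ∈ S, α ≠ 0 → HasDerivWithinAt f d S α →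
      IsMaxOn (fun a => σ * f a) S α →
      (θ ≤ μ ∧ d ≤ 0 ∧ 0 ≤ σ * (Real.exp (-α) - 1)) ∨
      (μ ≤ θ ∧ 0 ≤ d ∧ σ * (Real.exp (-α) - 1) ≤ 0)) :
    ∀ t ∈ Icc 0 T, ∀ α ∈ S, σ * (M t α - Mf t α) ≤ 0 := by
  obtain ⟨L, hL⟩ := isCompact_Icc.exists_bound_of_continuousOn (s := Icc 0 T) hlam.continuousOn
  obtain ⟨G₁, hG₁⟩ := hS.exists_bound_of_continuousOn (f := fun α => Real.exp α - 1)
    (by fun_prop)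
  obtain ⟨G₂, hG₂⟩ := hS.exists_bound_of_continuousOn (f := fun α => Real.exp (-α) - 1)
    (by fun_prop)
  -- In K, `L * G₁` bounds the arrival coefficient and `G₂ * (|θ - μ| * c)` the error left by the
  -- departure gap.
  refine nonpos_of_deriv_le_at_spatial_max (w := fun t α => σ * (M t α - Mf t α)) hS
    (K := L * G₁ + G₂ * (|θ - μ| * c)) (continuousOn_const.mul (hcont.sub hMf.cont))
    (fun α hα => by simp [hinit α hα]) ?_
  intro t ht α hα hpos hmax
  have ht' : t ∈ Icc 0 T := ⟨ht.1.le, ht.2⟩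
  have hα0 : α ≠ 0 := by
    rintro rfl
    simp [hzero t ht'] at hpos
  obtain ⟨p, r, hp, htime, hr, hrc⟩ := hM t ht' α hα hα0
  obtain ⟨pf, hpf, htimef⟩ := hMf.pde t ht' α hα
  refine ⟨_, (htime.sub htimef).const_mul σ, ?_⟩
  set m := M t α
  set mf := Mf t α
  set B := θ * (p - pf) + (μ - θ) * (r - min pf (c * mf)) with hB
  have hc : (0 : ℝ) ≤ c := c.cast_nonneg
  have hw : |m - mf| = σ * (m - mf) := by
    rw [← abs_of_pos hpos, abs_mul, hσ, one_mul]
  have hg : 0 ≤ |θ - μ| * c * |m - mf| := by positivity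
  have key : σ * (Real.exp (-α) - 1) * B ≤ |Real.exp (-α) - 1| * (|θ - μ| * c * |m - mf|) := by
    have habs : |σ * (Real.exp (-α) - 1)| = |Real.exp (-α) - 1| := by rw [abs_mul, hσ, one_mul]
    rw [← habs]
    rcases hside (fun a => M t a - Mf t a) (p - pf) α hα hα0 (hp.sub hpf) hmax with
      ⟨h1, h2, h3⟩ | ⟨h1, h2, h3⟩
    · rw [abs_of_nonneg h3]
      exact mul_le_mul_of_nonneg_left
        (departure_gap_le hθ hc h1 (sub_nonpos.1 h2) hr hrc) h3
    · rw [abs_of_nonpos h3]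
      have := mul_le_mul_of_nonneg_left
        (le_departure_gap (mf := mf) hμ hc h1 (sub_nonneg.1 h2) hr hrc) (neg_nonneg.2 h3)
      rw [← hB] at this
      linarith
  have key2 : |Real.exp (-α) - 1| * (|θ - μ| * c * |m - mf|) ≤ G₂ * (|θ - μ| * c * |m - mf|) :=
    mul_le_mul_of_nonneg_right (hG₂ α hα) hg
  have key3 : lam t * (Real.exp α - 1) * (σ * (m - mf)) ≤ L * G₁ * (σ * (m - mf)) := by
    refine mul_le_mul_of_nonneg_right ((le_abs_self _).trans ?_) hpos.le
    rw [abs_mul]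
    exact mul_le_mul (hL t ht') (hG₁ α hα) (abs_nonneg _) ((abs_nonneg _).trans (hL t ht'))
  rw [hw] at key key2
  calc _ = lam t * (Real.exp α - 1) * (σ * (m - mf)) + σ * (Real.exp (-α) - 1) * B := by
        rw [hB]; ring
    _ ≤ L * G₁ * (σ * (m - mf)) + G₂ * (|θ - μ| * c * (σ * (m - mf))) :=
        add_le_add key3 (key.trans key2)
    _ = _ := by ring

theorem IsFluidMGF.mono {lam : ℝ → ℝ} {μ θ T : ℝ} {c : ℕ} {J S : Set ℝ} {M : ℝ → ℝ → ℝ}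
    (hM : IsFluidMGF lam μ θ c T J M) (hS : S ⊆ J) : IsFluidMGF lam μ θ c T S M where
  pos t ht α hα := hM.pos t ht α (hS hα)
  cont := hM.cont.mono (prod_mono_right hS)
  pde t ht α hα := by
    obtain ⟨p, h1, h2⟩ := hM.pde t ht α (hS hα)
    exact ⟨p, h1.mono hS, h2⟩

theorem fluid_comparison_right {lam : ℝ → ℝ} {μ θ T σ b : ℝ} {c : ℕ} {M Mf : ℝ → ℝ → ℝ}
    (hlam : Continuous lam) (hμ : 0 ≤ μ) (hθ : 0 ≤ θ)
    (hσ : (σ = -1 ∧ θ ≤ μ) ∨ (σ = 1 ∧ μ ≤ θ))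
    (hMf : IsFluidMGF lam μ θ c T (Icc 0 b) Mf)
    (hcont : ContinuousOn (fun z : ℝ × ℝ => M z.1 z.2) (Icc 0 T ×ˢ Icc 0 b))
    (hinit : ∀ α ∈ Icc 0 b, M 0 α = Mf 0 α) (hzero : ∀ t ∈ Icc 0 T, M t 0 = Mf t 0)
    (hM : ∀ t ∈ Icc 0 T, ∀ α ∈ Icc 0 b, α ≠ 0 → ∃ p r, HasDerivWithinAt (M t) p (Icc 0 b) α ∧
      HasDerivWithinAt (fun s => M s α) (lam t * (Real.exp α - 1) * M t α +
        (Real.exp (-α) - 1) * (θ * p + (μ - θ) * r)) (Icc 0 T) t ∧ r ≤ p ∧ r ≤ c * M t α) :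
    ∀ t ∈ Icc 0 T, ∀ α ∈ Icc 0 b, σ * (M t α - Mf t α) ≤ 0 := by
  refine fluid_comparison hlam hμ hθ isCompact_Icc (by rcases hσ with h | h <;> simp [h.1]) hMf
    hcont hinit hzero hM fun f d α hα hα0 hd hmax => ?_
  have hexp : Real.exp (-α) - 1 ≤ 0 := by
    rw [sub_nonpos, Real.exp_le_one_iff]; linarith [hα.1]
  -- The maximum may sit at the outer end b, where only this one-sided sign survives.
  have := (hd.const_mul σ).nonneg_of_isMaxOn_Icc ⟨lt_of_le_of_ne hα.1 hα0.symm, hα.2⟩ hmax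
  rcases hσ with ⟨rfl, h⟩ | ⟨rfl, h⟩
  · exact Or.inl ⟨h, by linarith, by linarith⟩
  · exact Or.inr ⟨h, by linarith, by linarith⟩

theorem fluid_comparison_left {lam : ℝ → ℝ} {μ θ T σ a : ℝ} {c : ℕ} {M Mf : ℝ → ℝ → ℝ}
    (hlam : Continuous lam) (hμ : 0 ≤ μ) (hθ : 0 ≤ θ)
    (hσ : (σ = 1 ∧ θ ≤ μ) ∨ (σ = -1 ∧ μ ≤ θ))
    (hMf : IsFluidMGF lam μ θ c T (Icc a 0) Mf)
    (hcont : ContinuousOn (fun z : ℝ × ℝ => M z.1 z.2) (Icc 0 T ×ˢ Icc a 0))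
    (hinit : ∀ α ∈ Icc a 0, M 0 α = Mf 0 α) (hzero : ∀ t ∈ Icc 0 T, M t 0 = Mf t 0)
    (hM : ∀ t ∈ Icc 0 T, ∀ α ∈ Icc a 0, α ≠ 0 → ∃ p r, HasDerivWithinAt (M t) p (Icc a 0) α ∧
      HasDerivWithinAt (fun s => M s α) (lam t * (Real.exp α - 1) * M t α +
        (Real.exp (-α) - 1) * (θ * p + (μ - θ) * r)) (Icc 0 T) t ∧ r ≤ p ∧ r ≤ c * M t α) :
    ∀ t ∈ Icc 0 T, ∀ α ∈ Icc a 0, σ * (M t α - Mf t α) ≤ 0 := by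
  refine fluid_comparison hlam hμ hθ isCompact_Icc (by rcases hσ with h | h <;> simp [h.1]) hMf
    hcont hinit hzero hM fun f d α hα hα0 hd hmax => ?_
  have hexp : 0 ≤ Real.exp (-α) - 1 := by
    rw [sub_nonneg, Real.one_le_exp_iff]; linarith [hα.2]
  have := (hd.const_mul σ).nonpos_of_isMaxOn_Icc ⟨hα.1, lt_of_le_of_ne hα.2 hα0⟩ hmax
  rcases hσ with ⟨rfl, h⟩ | ⟨rfl, h⟩
  · exact Or.inl ⟨h, by linarith, by linarith⟩
  · exact Or.inr ⟨h, by linarith, by linarith⟩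

/-! ### Comparison for the queue -/

section

variable {Ω : Type*} [mΩ : MeasurableSpace Ω] {P : Measure Ω} [IsProbabilityMeasure P]
  {ℱ : Filtration ℝ≥0 mΩ} {lam : ℝ → ℝ} {μ θ T : ℝ} {c : ℕ} {Q : ℝ≥0 → Ω → ℕ} {Mf : ℝ → ℝ → ℝ}

/-- Time continuity comes from the forward equation, which needs α < β. The alternative b = 0 covers
α = β = 0, where the function is constantly 1; joint continuity follows from monotonicity in α. -/
theorem IsErlangA.continuousOn_expectAt_expFun_prod (hQ : IsErlangA P ℱ lam μ θ c Q) (hμ : 0 ≤ μ)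
    (hθ : 0 ≤ θ) (hlam : Continuous lam) {a b β C : ℝ} (hT : 0 ≤ T) (hab : a ≤ b) (hbβ : b ≤ β)
    (hβ : b < β ∨ b = 0)
    (hC : ∀ t ∈ Icc 0 T, Integrable (fun ω => expFun β (Q t.toNNReal ω)) P ∧
      expectAt P Q (expFun β) t ≤ C) :
    ContinuousOn (fun z : ℝ × ℝ => expectAt P Q (expFun z.2) z.1) (Icc 0 T ×ˢ Icc a b) := by
  refine continuousOn_uncurry_Icc_of_monotoneOn (F := fun t α => expectAt P Q (expFun α) t)
    hT hab (fun α hα => ?_)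
    (fun t ht => (hQ.continuousOn_expectAt_expFun (hC t ht).1).mono
      fun x hx => hx.2.trans hbβ)
    (fun t ht => (hQ.monotoneOn_expectAt_expFun (hC t ht).1).mono
      fun x hx => hx.2.trans hbβ)
  by_cases h : α < β
  · intro t ht
    obtain ⟨p, r, -, h, -⟩ := hQ.exists_hasDeriv_expectAt_expFun hμ hθ hlam h hC ht
    exact h.continuousWithinAt
  · have : α = 0 := by
      rcases hβ with h' | h'
      · exact absurd (hα.2.trans_lt h') h
      · linarith [hα.2, not_lt.1 h]
    subst this
    simp only [IsErlangA.expectAt_expFun_zero]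
    exact continuousOn_const

theorem IsErlangA.comparison_right (hQ : IsErlangA P ℱ lam μ θ c Q) (hμ : 0 ≤ μ)
    (hθ : 0 ≤ θ) (hlam : Continuous lam) (hlam0 : ∀ t, 0 ≤ t → 0 ≤ lam t) {β σ : ℝ} (hβ : 0 < β)
    (hσ : (σ = -1 ∧ θ ≤ μ) ∨ (σ = 1 ∧ μ ≤ θ))
    (h0 : Integrable (fun ω => expFun β (Q 0 ω)) P)
    (hMf : IsFluidMGF lam μ θ c T (Icc 0 β) Mf)
    (hinit : ∀ α ∈ Icc 0 β, expectAt P Q (expFun α) 0 = Mf 0 α) {t : ℝ} (ht : t ∈ Icc 0 T) :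
    σ * (expectAt P Q (expFun β) t - Mf t β) ≤ 0 := by
  obtain ⟨C, hC⟩ := hQ.exp_moment_bound hμ hθ hlam hlam0 hβ.le h0 T
  have hT := ht.1.trans ht.2
  have hzero : ∀ t ∈ Icc 0 T, expectAt P Q (expFun 0) t = Mf t 0 := fun t ht => by
    rw [hMf.eq_initial_at_zero ⟨le_rfl, hβ.le⟩ ht, ← hinit 0 ⟨le_rfl, hβ.le⟩,
      IsErlangA.expectAt_expFun_zero, IsErlangA.expectAt_expFun_zero]
  have hlt : ∀ b ∈ Ioo 0 β, σ * (expectAt P Q (expFun b) t - Mf t b) ≤ 0 := by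
    intro b hb
    have hsub : Icc 0 b ⊆ Icc 0 β := Icc_subset_Icc_right hb.2.le
    exact fluid_comparison_right (M := fun t α => expectAt P Q (expFun α) t) hlam hμ hθ hσ
      (hMf.mono hsub)
      (hQ.continuousOn_expectAt_expFun_prod hμ hθ hlam hT hb.1.le hb.2.le (Or.inl hb.2) hC)
      (fun α hα => hinit α (hsub hα)) hzero
      (fun s hs α hα _ => by
        obtain ⟨p, r, h1, h2⟩ := hQ.exists_hasDeriv_expectAt_expFun hμ hθ hlam
          (hα.2.trans_lt hb.2) hC hs
        exact ⟨p, r, h1.hasDerivWithinAt, h2⟩) t ht b ⟨hb.1.le, le_rfl⟩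
  -- At β itself no higher moment is available, so the inequality is obtained for b < β and carried
  -- over by left continuity.
  have hc1 : ContinuousWithinAt (fun b => σ * (expectAt P Q (expFun b) t - Mf t b)) (Ioo 0 β) β := by
    refine continuousWithinAt_const.mul (ContinuousWithinAt.sub ?_ ?_)
    · exact (hQ.continuousOn_expectAt_expFun (hC t ht).1 β (mem_Iic.2 le_rfl)).mono fun x hx => hx.2.le
    · obtain ⟨p, hp, -⟩ := hMf.pde t ht β ⟨hβ.le, le_rfl⟩
      exact hp.continuousWithinAt.mono Ioo_subset_Icc_self
  have : (𝓝[Ioo 0 β] β).NeBot := by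
    rw [← mem_closure_iff_nhdsWithin_neBot, closure_Ioo hβ.ne]
    exact right_mem_Icc.2 hβ.le
  refine le_of_tendsto hc1 ?_
  filter_upwards [self_mem_nhdsWithin] with b hb using hlt b hb

theorem IsErlangA.comparison_left (hQ : IsErlangA P ℱ lam μ θ c Q) (hμ : 0 ≤ μ)
    (hθ : 0 ≤ θ) (hlam : Continuous lam) {a σ : ℝ} (ha : a < 0)
    (hσ : (σ = 1 ∧ θ ≤ μ) ∨ (σ = -1 ∧ μ ≤ θ))
    (hMf : IsFluidMGF lam μ θ c T (Icc a 0) Mf)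
    (hinit : ∀ α ∈ Icc a 0, expectAt P Q (expFun α) 0 = Mf 0 α) {t : ℝ} (ht : t ∈ Icc 0 T) :
    σ * (expectAt P Q (expFun a) t - Mf t a) ≤ 0 := by
  -- For negative exponents the dominating moment is the trivial one, β = 0 with C = 1. It is not
  -- strictly larger at α = 0, but the equation is not needed there.
  have hC : ∀ t ∈ Icc 0 T, Integrable (fun ω => expFun 0 (Q t.toNNReal ω)) P ∧
      expectAt P Q (expFun 0) t ≤ 1 := fun t _ =>
    ⟨by simp [expFun], (IsErlangA.expectAt_expFun_zero t).le⟩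
  have hT := ht.1.trans ht.2
  have hzero : ∀ t ∈ Icc 0 T, expectAt P Q (expFun 0) t = Mf t 0 := fun t ht => by
    rw [hMf.eq_initial_at_zero ⟨ha.le, le_rfl⟩ ht, ← hinit 0 ⟨ha.le, le_rfl⟩,
      IsErlangA.expectAt_expFun_zero, IsErlangA.expectAt_expFun_zero]
  exact fluid_comparison_left (M := fun t α => expectAt P Q (expFun α) t) hlam hμ hθ hσ hMf
    (hQ.continuousOn_expectAt_expFun_prod hμ hθ hlam hT ha.le le_rfl (Or.inr rfl) hC)
    hinit hzero
    (fun s hs α hα hα0 => by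
      obtain ⟨p, r, h1, h2⟩ := hQ.exists_hasDeriv_expectAt_expFun hμ hθ hlam
        (lt_of_le_of_ne hα.2 hα0) hC hs
      exact ⟨p, r, h1.hasDerivWithinAt, h2⟩) t ht a ⟨le_rfl, ha.le⟩

end

theorem mainTheorem4 {Ω : Type*} [mΩ : MeasurableSpace Ω] (P : Measure Ω) [IsProbabilityMeasure P]
    (ℱ : Filtration ℝ≥0 mΩ) (lam : ℝ → ℝ) (μ θ : ℝ) (c : ℕ)
    (hlam_cont : ContinuousOn lam (Ici 0)) (hlam_nonneg : ∀ t, 0 ≤ t → 0 ≤ lam t)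
    (hμ : 0 < μ) (hθ : 0 ≤ θ) (hc : 0 < c)
    (Q : ℝ≥0 → Ω → ℕ) (hQ : IsErlangA P ℱ lam μ θ c Q)
    (T : ℝ) (J : Set ℝ) (hJ : J.OrdConnected) (hJ0 : (0 : ℝ) ∈ J)
    (Mf : ℝ → ℝ → ℝ) (hMf : IsFluidMGF lam μ θ c T J Mf)
    (hinit_int : ∀ α ∈ J, Integrable (fun ω => Real.exp (α * (Q 0 ω : ℝ))) P)
    (hinit : ∀ α ∈ J, Mf 0 α = mgf (fun ω => (Q 0 ω : ℝ)) P α) :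
    ∀ t : ℝ≥0, (t : ℝ) ≤ T → ∀ α ∈ J,
      Integrable (fun ω => Real.exp (α * (Q t ω : ℝ))) P ∧
      (0 ≤ α →
        (θ < μ → Real.log (Mf t α) ≤ cgf (fun ω => (Q t ω : ℝ)) P α) ∧
        (μ < θ → cgf (fun ω => (Q t ω : ℝ)) P α ≤ Real.log (Mf t α))) ∧
      (α ≤ 0 →
        (θ < μ → cgf (fun ω => (Q t ω : ℝ)) P α ≤ Real.log (Mf t α)) ∧
        (μ < θ → Real.log (Mf t α) ≤ cgf (fun ω => (Q t ω : ℝ)) P α)) ∧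
      (θ = μ → cgf (fun ω => (Q t ω : ℝ)) P α = Real.log (Mf t α)) := by
  intro t htT α hα
  have ht : (t : ℝ) ∈ Icc 0 T := ⟨t.coe_nonneg, htT⟩
  have hext : ∀ s, 0 ≤ s → lam (max s 0) = lam s := fun s hs => by rw [max_eq_left hs]
  -- The constant extension to negative times supplies the global continuity of the rate used above.
  have hlam' : Continuous fun s => lam (max s 0) :=
    hlam_cont.comp_continuous (by fun_prop) fun s => mem_Ici.2 (le_max_right _ _)
  have hlam0' : ∀ s, 0 ≤ s → 0 ≤ lam (max s 0) := fun s _ => hlam_nonneg _ (le_max_right _ _)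
  have hQ' := hQ.congr_rate hext
  have hMf' := hMf.congr_rate hext
  have hinit' : ∀ a ∈ J, expectAt P Q (expFun a) 0 = Mf 0 a := fun a ha => by
    rw [hinit a ha, expectAt, Real.toNNReal_zero]; rfl
  have hmgf : mgf (fun ω => (Q t ω : ℝ)) P α = expectAt P Q (expFun α) t := by
    rw [expectAt, Real.toNNReal_coe]; rfl
  have hint : Integrable (fun ω => Real.exp (α * (Q t ω : ℝ))) P := by
    rcases le_total 0 α with h | h
    · obtain ⟨C, hC⟩ := hQ'.exp_moment_bound hμ.le hθ hlam' hlam0' h (hinit_int α hα) T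
      simpa [expFun] using (hC t ht).1
    · exact hQ'.integrable_expFun_of_le (β := 0) h (by simp [expFun])
  have hMpos : 0 < expectAt P Q (expFun α) t := hmgf ▸ mgf_pos hint
  have hMfpos := hMf.pos t ht α hα
  have hcgf : cgf (fun ω => (Q t ω : ℝ)) P α = Real.log (expectAt P Q (expFun α) t) := by
    rw [cgf, hmgf]
  have hzero : expectAt P Q (expFun 0) t = Mf t 0 := by
    rw [hMf.eq_initial_at_zero hJ0 ht, ← hinit' 0 hJ0, IsErlangA.expectAt_expFun_zero,
      IsErlangA.expectAt_expFun_zero]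
  have hright : 0 ≤ α → (θ ≤ μ → Mf t α ≤ expectAt P Q (expFun α) t) ∧
      (μ ≤ θ → expectAt P Q (expFun α) t ≤ Mf t α) := by
    intro h
    rcases h.eq_or_lt with rfl | h
    · exact ⟨fun _ => hzero.ge, fun _ => hzero.le⟩
    · have hsub : Icc 0 α ⊆ J := hJ.out hJ0 hα
      have key := fun σ hσ => hQ'.comparison_right (σ := σ) hμ.le hθ hlam' hlam0' h hσ
        (hinit_int α hα) (hMf'.mono hsub) (fun a ha => hinit' a (hsub ha)) ht
      exact ⟨fun h => by linarith [key (-1) (Or.inl ⟨rfl, h⟩)],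
        fun h => by linarith [key 1 (Or.inr ⟨rfl, h⟩)]⟩
  have hleft : α ≤ 0 → (θ ≤ μ → expectAt P Q (expFun α) t ≤ Mf t α) ∧
      (μ ≤ θ → Mf t α ≤ expectAt P Q (expFun α) t) := by
    intro h
    rcases h.eq_or_lt with rfl | h
    · exact ⟨fun _ => hzero.le, fun _ => hzero.ge⟩
    · have hsub : Icc α 0 ⊆ J := hJ.out hα hJ0
      have key := fun σ hσ => hQ'.comparison_left (σ := σ) hμ.le hθ hlam' h hσ
        (hMf'.mono hsub) (fun a ha => hinit' a (hsub ha)) ht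
      exact ⟨fun h => by linarith [key 1 (Or.inl ⟨rfl, h⟩)],
        fun h => by linarith [key (-1) (Or.inr ⟨rfl, h⟩)]⟩
  rw [hcgf]
  refine ⟨hint, fun h => ⟨fun h' => Real.log_le_log hMfpos ((hright h).1 h'.le),
    fun h' => Real.log_le_log hMpos ((hright h).2 h'.le)⟩,
    fun h => ⟨fun h' => Real.log_le_log hMpos ((hleft h).1 h'.le),
    fun h' => Real.log_le_log hMfpos ((hleft h).2 h'.le)⟩, fun h' => ?_⟩
  -- For θ = μ both weak comparisons apply at once.
  rcases le_total 0 α with h | h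
  · rw [le_antisymm ((hright h).2 h'.ge) ((hright h).1 h'.le)]
  · rw [le_antisymm ((hleft h).1 h'.le) ((hleft h).2 h'.ge)]
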